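/- Let $m,n\ge 2$. An $m\times n$ instance of the Torus Puzzle is an $m\times n$ matrix whose entries are all and only the integers $1,\dots,mn$. A unit rotation is a circular shift by one position of a single row (rightward or leftward) or of a single column (downward or upward). A matrix is sorted if its entry in row $i$ and column $j$ is $(i-1)n+j$ for all $i,j$, and an instance is sortable if some finite sequence of unit rotations turns it into the sorted matrix. The push number of a sortable instance is the minimum length of such a sequence. Theorem. There are an absolute constant $C$ and an algorithm (a computable function, the same for all $m,n$) that, given any sortable $m\times n$ instance $A$ of the Torus Puzzle with $m,n\ge 2$, outputs a sequence of at most $C\,mn\log\max\{m,n\}$ rotations that sorts $A$, each of them a unit rightward rotation of a row or a unit downward rotation of a column. In particular, the push number of $A$ is at most $C\,mn\log\max\{m,n\}$. -/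

import Mathlib

namespace TorusPuzzle

/-- An `m × n` instance of the Torus Puzzle: the entries of the matrix are all and only the
integers from `1` to `m * n`. -/
def IsInstance {m n : ℕ} (A : Matrix (Fin m) (Fin n) ℕ) : Prop :=
  (∀ i j, 1 ≤ A i j ∧ A i j ≤ m * n) ∧
    ∀ x : ℕ, 1 ≤ x → x ≤ m * n → ∃! p : Fin m × Fin n, A p.1 p.2 = x

/-- The sorted configuration: increasing from left to right and from top to bottom.
With rows and columns numbered from `1`, its entry at `(i, j)` is `(i - 1) * n + j`;
indices of type `Fin` are numbered from `0`. -/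
def sorted (m n : ℕ) : Matrix (Fin m) (Fin n) ℕ :=
  fun i j => (i : ℕ) * n + (j : ℕ) + 1

/-- The unit rotations of the original puzzle: any row can be rotated by one position
rightward or leftward, any column by one position downward or upward. -/
inductive Rotation (m n : ℕ) : Type
  | right (i : Fin m) : Rotation m n
  | left (i : Fin m) : Rotation m n
  | down (j : Fin n) : Rotation m n
  | up (j : Fin n) : Rotation m n

/-- The effect of a unit rotation on a matrix. The permutation `finRotate k` is `t ↦ t + 1`
modulo `k`, so that after a rightward rotation the entry at column `j` is the one that was
at column `j - 1`. -/
def Rotation.apply {m n : ℕ} (A : Matrix (Fin m) (Fin n) ℕ) :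
    Rotation m n → Matrix (Fin m) (Fin n) ℕ
  | .right i => A.updateRow i fun j => A i ((finRotate n).symm j)
  | .left i => A.updateRow i fun j => A i (finRotate n j)
  | .down j => A.updateCol j fun i => A ((finRotate m).symm i) j
  | .up j => A.updateCol j fun i => A (finRotate m i) j

/-- The configuration obtained from `A` by performing the rotations of a sequence, in order. -/
def applySeq {m n : ℕ} (A : Matrix (Fin m) (Fin n) ℕ) (S : List (Rotation m n)) :
    Matrix (Fin m) (Fin n) ℕ :=
  S.foldl Rotation.apply A

/-- A sequence of rotations sorts `A`. -/
def Sorts {m n : ℕ} (S : List (Rotation m n)) (A : Matrix (Fin m) (Fin n) ℕ) : Prop :=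
  applySeq A S = sorted m n

/-- `A` can be sorted by some sequence of row and column rotations, in any directions. -/
def Sortable {m n : ℕ} (A : Matrix (Fin m) (Fin n) ℕ) : Prop :=
  ∃ S : List (Rotation m n), Sorts S A

/-- The push number of a sortable matrix: the minimum number of unit rotations, in any
directions, that sort it. (It is meaningful only for sortable matrices.) -/
noncomputable def pushNumber {m n : ℕ} (A : Matrix (Fin m) (Fin n) ℕ) : ℕ :=
  sInf {k : ℕ | ∃ S : List (Rotation m n), Sorts S A ∧ S.length = k}

/-- The moves of the restricted model: `Sum.inl i` is the unit rightward rotation of row `i`,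
and `Sum.inr j` is the unit downward rotation of column `j`. -/
abbrev Move (m n : ℕ) : Type := Fin m ⊕ Fin n

/-- A move of the restricted model as a rotation of the original puzzle. -/
def Move.toRotation {m n : ℕ} : Move m n → Rotation m n
  | .inl i => .right i
  | .inr j => .down j

/-- A matrix as the input of an algorithm: the list of its rows. -/
def encodeMatrix {m n : ℕ} (A : Matrix (Fin m) (Fin n) ℕ) : List (List ℕ) :=
  List.ofFn fun i => List.ofFn fun j => A i j

/-- A sequence of moves as the output of an algorithm: each move is given by its kind
(row or column) and by the index of the row or column. -/
def encodeMoves {m n : ℕ} (S : List (Move m n)) : List (ℕ ⊕ ℕ) :=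
  S.map (Sum.map Fin.val Fin.val)

end TorusPuzzle

/-! The bound obtained is linear: 33mn moves suffice, and log max{m,n} ≥ log 2 absorbs the rest. A
sequence of moves matters only through its permutation of the positions, so the question is which
permutations are cheap (`Reach`).

The basic gadget is `reach_conj_allDown`: while the first row makes one full revolution, each column
is pushed down once, at a moment of free choice. For 2n moves, all columns move down and the
outgoing first row is permuted at will. Repeating this m times prescribes every row except the first
(`exists_reach_rowHom`).

What remains is an even permutation of the first row. It is a product of two commutators
(`exists_conj_mul_of_sign_eq_one`), and each commutator comes from gadgets whose effects on the
second row cancel (`reach_row0`). Hence even row permutations cost 10mn moves and, by transposition,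
so do even column permutations.

By edge coloring, every permutation of the grid is a row, then a column, then a row permutation
(`exists_row_column_row`). The factors may be odd; transpositions inserted between them repair the
signs, a row transposition being exchanged for a column one by a commutator of two moves. An odd
target needs one more odd move. With a length bound known, exhaustive search is an algorithm. -/

namespace TorusPuzzle

open Equiv Equiv.Perm

/-! ### Even permutations as products of commutators. -/

section PermutationGroups

variable {α : Type*}

/-- A permutation is an involution times a permutation of odd order, both supported where it is. -/
theorem exists_involution_mul_odd_order [Fintype α] [DecidableEq α] (ε : Perm α) :
    ∃ T E : Perm α, ε = T * E ∧ T * T = 1 ∧ (∃ k, Odd k ∧ E ^ k = 1) ∧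
      T.support ⊆ ε.support ∧ E.support ⊆ ε.support := by
  induction ε using cycle_induction_on with
  | base_one => exact ⟨1, 1, by simp, by simp, ⟨1, odd_one, by simp⟩, by simp, by simp⟩
  | base_cycles c hc =>
    rcases Nat.even_or_odd (orderOf c) with he | ho
    · obtain ⟨x, hx, -⟩ := id hc
      by_cases h2 : c (c x) = x
      · have h := hc.eq_swap_of_apply_apply_eq_self hx h2
        refine ⟨c, 1, by simp, ?_, ⟨1, odd_one, by simp⟩, by simp, by simp⟩
        rw [h]; simp
      -- A transposition removes `x` from the even cycle and leaves a cycle of odd length.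
      · have hsupp : (swap x (c x) * c).support = c.support \ {x} := support_swap_mul_eq c x h2
        refine ⟨swap x (c x), swap x (c x) * c, by simp, by simp, ⟨c.support.card - 1, ?_, ?_⟩,
          ?_, ?_⟩
        · rw [hc.orderOf] at he
          have : 0 < c.support.card := Finset.card_pos.2 ⟨x, by simpa using hx⟩
          grind
        · have h3 := (hc.swap_mul hx h2).orderOf
          rw [hsupp, Finset.card_sdiff_of_subset (by simpa using hx), Finset.card_singleton] at h3
          rw [← h3, pow_orderOf_eq_one]
        · rw [support_swap (Ne.symm hx)]
          intro y hy
          simp only [Finset.mem_insert, Finset.mem_singleton] at hy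
          rcases hy with rfl | rfl <;> simpa using hx
        · rw [hsupp]; exact Finset.sdiff_subset
    · exact ⟨1, c, by simp, by simp, ⟨_, ho, pow_orderOf_eq_one c⟩, by simp, by simp⟩
  | induction_disjoint σ τ hd _ hσ hτ =>
    obtain ⟨T, E, h1, h2, ⟨k, hk, h3⟩, h4, h5⟩ := hσ
    obtain ⟨T', E', h1', h2', ⟨k', hk', h3'⟩, h4', h5'⟩ := hτ
    have key : ∀ {a b : Perm α}, a.support ⊆ σ.support → b.support ⊆ τ.support → a * b = b * a :=
      fun ha hb => (disjoint_iff_disjoint_support.2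
        ((disjoint_iff_disjoint_support.1 hd).mono ha hb)).commute.eq
    refine ⟨T * T', E * E', ?_, ?_, ⟨k * k', hk.mul hk', ?_⟩, ?_, ?_⟩
    · rw [h1, h1', mul_assoc, ← mul_assoc E, key h5 h4']; simp only [mul_assoc]
    · rw [mul_assoc, ← mul_assoc T', ← key h4 h4', mul_assoc, h2', mul_one, h2]
    · rw [(show Commute E E' from key h5 h5').mul_pow, pow_mul, h3, one_pow, mul_comm k, pow_mul,
        h3', one_pow, one_mul]
    · rw [hd.support_mul]
      exact (support_mul_le _ _).trans (sup_le_sup h4 h4')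
    · rw [hd.support_mul]
      exact (support_mul_le _ _).trans (sup_le_sup h5 h5')

/-- An even involution is a product of two conjugate permutations. -/
theorem exists_isConj_mul_of_involution [Fintype α] [DecidableEq α] (T : Perm α) (hT : T * T = 1)
    (hs : sign T = 1) :
    ∃ u v : Perm α, T = u * v ∧ u.cycleType = v.cycleType ∧
      u.support ⊆ T.support ∧ v.support ⊆ T.support := by
  induction hn : T.support.card using Nat.strong_induction_on generalizing T with
  | _ N ih =>
  have hTT : ∀ x, T (T x) = x := fun x => by rw [← Perm.mul_apply, hT, Perm.one_apply]
  by_cases h1 : T = 1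
  · exact ⟨1, 1, by simp [h1], rfl, by simp, by simp⟩
  obtain ⟨x, hx⟩ : ∃ x, T x ≠ x := by
    by_contra! h
    exact h1 (Perm.ext h)
  -- A lone transposition is odd, so an even involution moves a second pair.
  obtain ⟨y, hy, hyx, hyTx⟩ : ∃ y, T y ≠ y ∧ y ≠ x ∧ y ≠ T x := by
    by_contra! h
    have : T = swap x (T x) := by
      ext z
      by_cases hzx : z = x
      · simp [hzx]
      by_cases hzT : z = T x
      · simp [hzT, hTT]
      · rw [swap_apply_of_ne_of_ne hzx hzT]
        by_contra hz
        exact hzT (h z hz hzx)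
    rw [this, sign_swap (Ne.symm hx)] at hs
    exact absurd hs (by decide)
  have hTyx : T y ≠ x := fun h => hyTx (by rw [← h, hTT])
  have hTyTx : T y ≠ T x := fun h => hyx (T.injective h)
  set a := swap x (T x) with ha
  set b := swap y (T y) with hb
  obtain ⟨S, hS⟩ : ∃ S, S = T * (a * b) := ⟨_, rfl⟩
  have hSap : ∀ z, S z = if z = x ∨ z = T x ∨ z = y ∨ z = T y then z else T z := by
    intro z
    rw [hS, Perm.mul_apply, Perm.mul_apply]
    split_ifs with hz
    · rcases hz with rfl | rfl | rfl | rfl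
      · rw [hb, swap_apply_of_ne_of_ne hyx.symm hTyx.symm, ha, swap_apply_left, hTT]
      · rw [hb, swap_apply_of_ne_of_ne hyTx.symm hTyTx.symm, ha, swap_apply_right]
      · rw [hb, swap_apply_left, ha, swap_apply_of_ne_of_ne hTyx hTyTx, hTT]
      · rw [hb, swap_apply_right, ha, swap_apply_of_ne_of_ne hyx hyTx]
    · push Not at hz
      rw [hb, swap_apply_of_ne_of_ne hz.2.2.1 hz.2.2.2, ha, swap_apply_of_ne_of_ne hz.1 hz.2.1]
  have hTS : T = S * (a * b) := by
    have : (a * b) * (a * b) = 1 := by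
      have hc : a * b = b * a := by
        refine Disjoint.commute ?_ |>.eq
        rw [disjoint_iff_disjoint_support, ha, hb, support_swap (Ne.symm hx),
          support_swap (Ne.symm hy), Finset.disjoint_left]
        intro z; simp only [Finset.mem_insert, Finset.mem_singleton]; grind
      rw [mul_assoc, ← mul_assoc b, ← hc, mul_assoc, ha, hb]; simp
    rw [hS, mul_assoc, this, mul_one]
  have hsub : S.support ⊆ T.support := by
    intro z hz
    rw [mem_support, hSap] at hz
    rw [mem_support]
    split_ifs at hz with h
    · exact absurd rfl hz
    · exact hz
  have hxS : ∀ z, (z = x ∨ z = T x ∨ z = y ∨ z = T y) → z ∉ S.support := by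
    intro z hz
    rw [mem_support, hSap, if_pos hz]; simp
  have hcard : S.support.card < N := by
    rw [← hn]
    exact Finset.card_lt_card ⟨hsub, fun h => hxS x (Or.inl rfl) (h (by simpa using hx))⟩
  obtain ⟨u, v, huv, hc, hu, hv⟩ := ih _ hcard S
    (by
      ext z
      rw [Perm.mul_apply, hSap z, Perm.one_apply]
      split_ifs with h
      · rw [hSap, if_pos h]
      · rw [hSap, if_neg, hTT]
        rintro (h' | h' | h' | h')
        · exact h (Or.inr (Or.inl (by rw [← h', hTT])))
        · exact h (Or.inl (T.injective h'))
        · exact h (Or.inr (Or.inr (Or.inr (by rw [← h', hTT]))))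
        · exact h (Or.inr (Or.inr (Or.inl (T.injective h')))))
    (by rw [hS, Perm.sign_mul, Perm.sign_mul, hs, ha, hb, sign_swap (Ne.symm hx), sign_swap (Ne.symm hy)]; rfl)
    rfl
  have hda : ∀ w : Perm α, w.support ⊆ S.support → Disjoint w a := by
    intro w hw
    rw [disjoint_iff_disjoint_support, ha, support_swap (Ne.symm hx), Finset.disjoint_right]
    intro z hz hz'
    simp only [Finset.mem_insert, Finset.mem_singleton] at hz
    exact hxS z (by tauto) (hw hz')
  have hdb : ∀ w : Perm α, w.support ⊆ S.support → Disjoint w b := by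
    intro w hw
    rw [disjoint_iff_disjoint_support, hb, support_swap (Ne.symm hy), Finset.disjoint_right]
    intro z hz hz'
    simp only [Finset.mem_insert, Finset.mem_singleton] at hz
    exact hxS z (by tauto) (hw hz')
  have hTsupp : ∀ z, T z ≠ z → ({z, T z} : Finset α) ⊆ T.support := by
    intro z hz w hw
    simp only [Finset.mem_insert, Finset.mem_singleton] at hw
    rcases hw with rfl | rfl <;> simpa using hz
  -- Each factor receives one of the two transpositions split off, which keeps the cycle types
  -- equal.
  refine ⟨u * a, v * b, ?_, ?_, ?_, ?_⟩
  · rw [hTS, huv, mul_assoc, mul_assoc, ← mul_assoc v, (hda v hv).commute.eq, mul_assoc]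
  · rw [(hda u hu).cycleType_mul, (hdb v hv).cycleType_mul, hc, ha, hb,
      IsCycle.cycleType (isCycle_swap (Ne.symm hx)),
      IsCycle.cycleType (isCycle_swap (Ne.symm hy)), card_support_swap (Ne.symm hx),
      card_support_swap (Ne.symm hy)]
  · rw [(hda u hu).support_mul, ha, support_swap (Ne.symm hx)]
    exact Finset.union_subset (hu.trans hsub) (hTsupp x hx)
  · rw [(hdb v hv).support_mul, hb, support_swap (Ne.symm hy)]
    exact Finset.union_subset (hv.trans hsub) (hTsupp y hy)

/-- Every even permutation is a product of two commutators, each written as a product of a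
permutation with a conjugate of its inverse. -/
theorem exists_conj_mul_of_sign_eq_one [Fintype α] [DecidableEq α] (ε : Perm α)
    (hε : sign ε = 1) :
    ∃ δ τ δ' τ' : Perm α, ε = (δ⁻¹ * (τ⁻¹ * δ * τ)) * (δ'⁻¹ * (τ'⁻¹ * δ' * τ')) := by
  have key : ∀ u v : Perm α, u.cycleType = v.cycleType → ∃ δ τ, u * v = δ⁻¹ * (τ⁻¹ * δ * τ) := by
    intro u v huv
    have : IsConj u⁻¹ v := by rw [isConj_iff_cycleType_eq, cycleType_inv, huv]
    obtain ⟨c, hc⟩ := isConj_iff.1 this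
    exact ⟨u⁻¹, c⁻¹, by rw [inv_inv, inv_inv, hc]⟩
  obtain ⟨T, E, h1, h2, ⟨k, ⟨l, rfl⟩, h3⟩, -, -⟩ := exists_involution_mul_odd_order ε
  -- An element of odd order is a square of one of its powers. Hence `E` is even, and so is `T`.
  have hE : E = E ^ (l + 1) * E ^ (l + 1) := by
    rw [← pow_add, show l + 1 + (l + 1) = (2 * l + 1) + 1 by ring, pow_succ, h3, one_mul]
  have hTs : sign T = 1 := by
    rw [h1, hE, Perm.sign_mul, Perm.sign_mul, Int.units_mul_self, mul_one] at hε
    exact hε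
  obtain ⟨u, v, huv, hc, -, -⟩ := exists_isConj_mul_of_involution T h2 hTs
  obtain ⟨δ, τ, h⟩ := key u v hc
  obtain ⟨δ', τ', h'⟩ := key (E ^ (l + 1)) (E ^ (l + 1)) rfl
  exact ⟨δ, τ, δ', τ', by rw [← h, ← h', ← huv, ← hE, h1]⟩

/-- The commutator of two permutations whose supports meet in one point. -/
theorem commutator_eq_swap_mul_swap [DecidableEq α] (g h : Perm α) (a : α)
    (hgh : ∀ x, g x ≠ x → h x ≠ x → x = a) (hg : g a ≠ a) (hh : h a ≠ a) :
    g * h * g⁻¹ * h⁻¹ = swap a (h a) * swap a (g a) := by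
  have hga : h (g a) = g a := by
    by_contra hc
    exact hg (hgh (g a) (fun h' => hg (g.injective h')) hc)
  have hha : g (h a) = h a := by
    by_contra hc
    exact hh (hgh (h a) hc (fun h' => hh (h.injective h')))
  have hne : g a ≠ h a := by
    intro hc
    exact hh (h.injective (by rw [← hc, hga, hc]))
  -- `h` is this transposition times a permutation disjoint from `g`, so both conjugate `g⁻¹` alike.
  have hconj : h * g⁻¹ * h⁻¹ = swap a (h a) * g⁻¹ * swap a (h a) := by
    have hcomm : (swap a (h a) * h) * g⁻¹ = g⁻¹ * (swap a (h a) * h) := by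
      have : Disjoint (swap a (h a) * h) g := by
        intro x
        by_cases hx : g x = x
        · exact Or.inr hx
        · left
          by_cases hxa : x = a
          · simp [hxa]
          · have hx' : h x = x := by
              by_contra hc
              exact hxa (hgh x hx hc)
            rw [Perm.mul_apply, hx', swap_apply_of_ne_of_ne hxa]
            rintro rfl
            exact hx hha
      exact this.commute.inv_right.eq
    have : h = swap a (h a) * (swap a (h a) * h) := by simp
    calc h * g⁻¹ * h⁻¹ = swap a (h a) * ((swap a (h a) * h) * g⁻¹) * h⁻¹ := by
          rw [← mul_assoc, ← this]
      _ = _ := by rw [hcomm]; simp [mul_assoc]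
  calc g * h * g⁻¹ * h⁻¹ = g * (h * g⁻¹ * h⁻¹) := by simp only [mul_assoc]
    _ = (g * swap a (h a) * g⁻¹) * swap a (h a) := by rw [hconj]; simp only [mul_assoc]
    _ = swap (g a) (h a) * swap a (h a) := by
        rw [← swap_apply_apply, hha]
    _ = swap a (h a) * swap a (g a) := by
        ext x
        simp only [Perm.mul_apply, swap_apply_def]
        grind

end PermutationGroups

/-! ### Edge coloring of regular bipartite multigraphs, and routing in a grid. -/

section EdgeColoring

variable {V E : Type*} [DecidableEq V]

/-- A regular bipartite multigraph has a perfect matching. -/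
theorem exists_perfect_matching {k : ℕ} (hk : 0 < k) (s t : E → V) (S : Finset E)
    (hs : ∀ v, (S.filter fun e => s e = v).card = k)
    (ht : ∀ v, (S.filter fun e => t e = v).card = k) :
    ∃ M : V → E, (∀ v, M v ∈ S) ∧ (∀ v, s (M v) = v) ∧ Function.Injective fun v => t (M v) := by
  have hall := (Finset.all_card_le_biUnion_card_iff_exists_injective
    (fun v : V => (S.filter fun e => s e = v).image t)).1 (by
      intro W
      -- Hall's condition by double counting: the k|W| edges leaving `W` are among the k|N| edges
      -- entering `N`.
      set N := W.biUnion fun v => (S.filter fun e => s e = v).image t with hN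
      have h1 : (S.filter fun e => s e ∈ W).card = k * W.card := by
        rw [Finset.card_eq_sum_card_fiberwise (f := s) (t := W) (by
          intro e he; simpa using (Finset.mem_filter.1 he).2), mul_comm, ← smul_eq_mul,
          ← Finset.sum_const]
        refine Finset.sum_congr rfl fun v hv => ?_
        rw [← hs v, Finset.filter_filter]
        congr 1; ext e; simp only [Finset.mem_filter]; grind
      have h2 : (S.filter fun e => t e ∈ N).card = k * N.card := by
        rw [Finset.card_eq_sum_card_fiberwise (f := t) (t := N) (by
          intro e he; simpa using (Finset.mem_filter.1 he).2), mul_comm, ← smul_eq_mul,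
          ← Finset.sum_const]
        refine Finset.sum_congr rfl fun v hv => ?_
        rw [← ht v, Finset.filter_filter]
        congr 1; ext e; simp only [Finset.mem_filter]; grind
      have h3 : (S.filter fun e => s e ∈ W) ⊆ S.filter fun e => t e ∈ N := by
        intro e he
        rw [Finset.mem_filter] at he ⊢
        refine ⟨he.1, Finset.mem_biUnion.2 ⟨s e, he.2, Finset.mem_image.2 ⟨e, ?_, rfl⟩⟩⟩
        simp [he.1]
      have := Finset.card_le_card h3
      rw [h1, h2] at this
      exact Nat.le_of_mul_le_mul_left this hk)
  obtain ⟨f, hf, hfm⟩ := hall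
  have : ∀ v, ∃ e ∈ S, s e = v ∧ t e = f v := by
    intro v
    obtain ⟨e, he, h⟩ := Finset.mem_image.1 (hfm v)
    rw [Finset.mem_filter] at he
    exact ⟨e, he.1, he.2, h⟩
  choose M hM1 hM2 hM3 using this
  refine ⟨M, hM1, hM2, ?_⟩
  intro v w h
  simp only [hM3] at h
  exact hf h

/-- A `k`-regular bipartite multigraph has a proper edge coloring with `k` colors. -/
theorem exists_edge_coloring [Fintype V] [DecidableEq E] (k : ℕ) (s t : E → V) (S : Finset E)
    (hs : ∀ v, (S.filter fun e => s e = v).card = k)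
    (ht : ∀ v, (S.filter fun e => t e = v).card = k) :
    ∃ c : E → ℕ, (∀ e ∈ S, c e < k) ∧
      (∀ e ∈ S, ∀ e' ∈ S, c e = c e' → s e = s e' → e = e') ∧
      (∀ e ∈ S, ∀ e' ∈ S, c e = c e' → t e = t e' → e = e') := by
  induction k generalizing S with
  | zero =>
    have : ∀ e, e ∉ S := by
      intro e he
      have := hs (s e)
      rw [Finset.card_eq_zero, Finset.filter_eq_empty_iff] at this
      exact this he rfl
    exact ⟨fun _ => 0, fun e he => absurd he (this e), fun e he => absurd he (this e),
      fun e he => absurd he (this e)⟩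
  | succ k ih =>
    obtain ⟨M, hMS, hMs, hMt⟩ := exists_perfect_matching k.succ_pos s t S hs ht
    have hMt' : Function.Surjective fun v => t (M v) := Finite.surjective_of_injective hMt
    set S' := S \ Finset.univ.image M with hS'
    have hmem : ∀ e, e ∈ S' ↔ e ∈ S ∧ ∀ v, M v ≠ e := by intro e; simp [hS']
    obtain ⟨c, hc, hcs, hct⟩ := ih S'
      (by
        intro v
        have : S'.filter (fun e => s e = v) = (S.filter fun e => s e = v).erase (M v) := by
          ext e
          simp only [Finset.mem_filter, Finset.mem_erase, hmem]
          grind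
        rw [this, Finset.card_erase_of_mem (by simp [hMS, hMs]), hs]; rfl)
      (by
        intro v
        obtain ⟨w, hw⟩ := hMt' v
        have : S'.filter (fun e => t e = v) = (S.filter fun e => t e = v).erase (M w) := by
          ext e
          simp only [Finset.mem_filter, Finset.mem_erase, hmem]
          constructor
          · rintro ⟨⟨h1, h2⟩, h3⟩
            exact ⟨(h2 w).symm, h1, h3⟩
          · rintro ⟨h1, h2, h3⟩
            refine ⟨⟨h2, ?_⟩, h3⟩
            rintro u rfl
            have : u = w := hMt (h3.trans hw.symm)
            exact h1 (by rw [this])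
        rw [this, Finset.card_erase_of_mem (by simp [hMS]; exact hw), ht]; rfl)
    have hnot : ∀ e ∈ S, e ∉ S' → ∃ v, M v = e := by
      intro e he he'
      by_contra! h
      exact he' ((hmem e).2 ⟨he, h⟩)
    refine ⟨fun e => if e ∈ S' then c e else k, ?_, ?_, ?_⟩
    · intro e _
      dsimp only
      split_ifs with h
      · exact (hc e h).trans k.lt_succ_self
      · exact k.lt_succ_self
    · intro e he e' he' h1 h2
      dsimp only at h1
      split_ifs at h1 with h h' h'
      · exact hcs e h e' h' h1 h2
      · exact absurd h1 (hc e h).ne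
      · exact absurd h1.symm (hc e' h').ne
      · obtain ⟨v, rfl⟩ := hnot e he h
        obtain ⟨w, rfl⟩ := hnot e' he' h'
        rw [hMs, hMs] at h2
        rw [h2]
    · intro e he e' he' h1 h2
      dsimp only at h1
      split_ifs at h1 with h h' h'
      · exact hct e h e' h' h1 h2
      · exact absurd h1 (hc e h).ne
      · exact absurd h1.symm (hc e' h').ne
      · obtain ⟨v, rfl⟩ := hnot e he h
        obtain ⟨w, rfl⟩ := hnot e' he' h'
        rw [hMt h2]

end EdgeColoring

/-- Every permutation of a grid is a permutation within the rows, followed by one within the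
columns, followed by one within the rows. -/
theorem exists_row_column_row {m n : ℕ} (P : Perm (Fin m × Fin n)) :
    ∃ ρ κ ρ' : Perm (Fin m × Fin n), P = ρ * κ * ρ' ∧ (∀ x, (ρ x).1 = x.1) ∧
      (∀ x, (κ x).2 = x.2) ∧ (∀ x, (ρ' x).1 = x.1) := by
  have hfib : ∀ v : Fin m, (Finset.univ.filter fun e : Fin m × Fin n => e.1 = v).card = n := by
    intro v
    have : (Finset.univ.filter fun e : Fin m × Fin n => e.1 = v) = {v} ×ˢ Finset.univ := by
      ext ⟨i, j⟩; simp [eq_comm]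
    rw [this, Finset.card_product]; simp
  have hfib' : ∀ v : Fin m,
      (Finset.univ.filter fun e : Fin m × Fin n => (P e).1 = v).card = n := by
    intro v
    refine Eq.trans ?_ (hfib v)
    refine Finset.card_bij (fun e _ => P e) (by simp) (fun a _ b _ h => P.injective h) ?_
    intro b hb
    exact ⟨P.symm b, by simpa using hb, by simp⟩
  -- Each cell is an edge from its row to its target row, and its color is the column through which
  -- it travels. Properness at the two ends makes the maps `f` and `g` below injective.
  obtain ⟨c, hc, hcs, hct⟩ := exists_edge_coloring n (fun e : Fin m × Fin n => e.1)
    (fun e => (P e).1) Finset.univ hfib hfib'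
  let c' : Fin m × Fin n → Fin n := fun e => ⟨c e, hc e (Finset.mem_univ e)⟩
  have h1 : Function.Bijective fun e : Fin m × Fin n => (e.1, c' e) := by
    refine Finite.injective_iff_bijective.1 fun e e' h => ?_
    simp only [Prod.mk.injEq, Fin.mk.injEq, c'] at h
    exact hcs e (Finset.mem_univ _) e' (Finset.mem_univ _) h.2 h.1
  have h2 : Function.Bijective fun e : Fin m × Fin n => ((P e).1, c' e) := by
    refine Finite.injective_iff_bijective.1 fun e e' h => ?_
    simp only [Prod.mk.injEq, Fin.mk.injEq, c'] at h
    exact hct e (Finset.mem_univ _) e' (Finset.mem_univ _) h.2 h.1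
  let f : Perm (Fin m × Fin n) := Equiv.ofBijective _ h1
  let g : Perm (Fin m × Fin n) := Equiv.ofBijective _ h2
  have hf : ∀ e, f e = (e.1, c' e) := fun e => rfl
  have hg : ∀ e, g e = ((P e).1, c' e) := fun e => rfl
  refine ⟨P * g⁻¹, g * f⁻¹, f, by group, ?_, ?_, fun x => by rw [hf]⟩
  · intro x
    obtain ⟨y, rfl⟩ := g.surjective x
    rw [Perm.mul_apply, show g⁻¹ (g y) = y from g.symm_apply_apply y, hg]
  · intro x
    obtain ⟨y, rfl⟩ := f.surjective x
    rw [Perm.mul_apply, show f⁻¹ (f y) = y from f.symm_apply_apply y, hg, hf]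

/-! ### Moves as permutations of the positions, and their cost. -/

variable {m n : ℕ}

/-- The permutation of the grid that permutes each row by the given permutation. -/
def rowHom : (Fin m → Perm (Fin n)) →* Perm (Fin m × Fin n) where
  toFun π := prodCongrRight π
  map_one' := by ext <;> simp
  map_mul' _ _ := by ext <;> simp

/-- The permutation of the grid that permutes each column by the given permutation. -/
def colHom : (Fin n → Perm (Fin m)) →* Perm (Fin m × Fin n) where
  toFun π := prodCongrLeft π
  map_one' := by ext <;> simp
  map_mul' _ _ := by ext <;> simp

@[simp] theorem rowHom_apply (π : Fin m → Perm (Fin n)) (x : Fin m × Fin n) :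
    rowHom π x = (x.1, π x.1 x.2) := rfl

@[simp] theorem colHom_apply (π : Fin n → Perm (Fin m)) (x : Fin m × Fin n) :
    colHom π x = (π x.2 x.1, x.2) := rfl

/-- The permutation of the positions effected by a rotation. -/
def rotPerm : Rotation m n → Perm (Fin m × Fin n)
  | .right i => rowHom (Pi.mulSingle i (finRotate n))
  | .left i => (rowHom (Pi.mulSingle i (finRotate n)))⁻¹
  | .down j => colHom (Pi.mulSingle j (finRotate m))
  | .up j => (colHom (Pi.mulSingle j (finRotate m)))⁻¹

/-- The permutation of the positions effected by a sequence of rotations. -/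
def seqPerm (S : List (Rotation m n)) : Perm (Fin m × Fin n) := (S.map rotPerm).reverse.prod

@[simp] theorem seqPerm_nil : seqPerm ([] : List (Rotation m n)) = 1 := rfl

@[simp] theorem seqPerm_cons (r : Rotation m n) (S : List (Rotation m n)) :
    seqPerm (r :: S) = seqPerm S * rotPerm r := by simp [seqPerm]

@[simp] theorem seqPerm_append (S T : List (Rotation m n)) :
    seqPerm (S ++ T) = seqPerm T * seqPerm S := by simp [seqPerm]

theorem rotation_apply_eq (A : Matrix (Fin m) (Fin n) ℕ) (r : Rotation m n) (x : Fin m × Fin n) :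
    Rotation.apply A r x.1 x.2 =
      A ((rotPerm r)⁻¹ x).1 ((rotPerm r)⁻¹ x).2 := by
  obtain ⟨i, j⟩ := x
  rcases r with i' | i' | j' | j'
  · rw [rotPerm, ← map_inv, ← Pi.mulSingle_inv]
    by_cases h : i = i'
    · subst h; simp [Rotation.apply]
    · simp [Rotation.apply, h]
  · rw [rotPerm, inv_inv]
    by_cases h : i = i'
    · subst h; simp [Rotation.apply]
    · simp [Rotation.apply, h]
  · rw [rotPerm, ← map_inv, ← Pi.mulSingle_inv]
    by_cases h : j = j'
    · subst h; simp [Rotation.apply]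
    · simp [Rotation.apply, h]
  · rw [rotPerm, inv_inv]
    by_cases h : j = j'
    · subst h; simp [Rotation.apply]
    · simp [Rotation.apply, h]

theorem applySeq_apply (A : Matrix (Fin m) (Fin n) ℕ) (S : List (Rotation m n))
    (x : Fin m × Fin n) :
    applySeq A S x.1 x.2 = A ((seqPerm S)⁻¹ x).1 ((seqPerm S)⁻¹ x).2 := by
  induction S generalizing A with
  | nil => rfl
  | cons r S ih =>
    have : applySeq A (r :: S) = applySeq (Rotation.apply A r) S := rfl
    rw [this, ih, rotation_apply_eq, seqPerm_cons, mul_inv_rev, Perm.mul_apply]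

/-- The permutation `P` of the positions is effected by at most `k` moves. -/
def Reach (k : ℕ) (P : Perm (Fin m × Fin n)) : Prop :=
  ∃ S : List (Move m n), seqPerm (S.map Move.toRotation) = P ∧ S.length ≤ k

theorem Reach.mono {k l : ℕ} {P : Perm (Fin m × Fin n)} (h : Reach k P) (hkl : k ≤ l) :
    Reach l P := by
  obtain ⟨S, h1, h2⟩ := h
  exact ⟨S, h1, h2.trans hkl⟩

theorem reach_one (k : ℕ) : Reach k (1 : Perm (Fin m × Fin n)) := ⟨[], rfl, by simp⟩

theorem reach_move (g : Move m n) : Reach 1 (rotPerm g.toRotation) := ⟨[g], by simp, by simp⟩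

theorem Reach.mul {k l : ℕ} {P Q : Perm (Fin m × Fin n)} (hP : Reach k P) (hQ : Reach l Q) :
    Reach (k + l) (P * Q) := by
  obtain ⟨S, rfl, h2⟩ := hP
  obtain ⟨T, rfl, h2'⟩ := hQ
  exact ⟨T ++ S, by simp, by simp; omega⟩

theorem Reach.pow {k : ℕ} {P : Perm (Fin m × Fin n)} (hP : Reach k P) (l : ℕ) :
    Reach (l * k) (P ^ l) := by
  induction l with
  | zero => exact reach_one _
  | succ l ih =>
    rw [pow_succ, Nat.succ_mul]
    exact ih.mul hP

/-- Leftward and upward rotations are not moves, so an inverse has to be paid for as a power. -/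
theorem Reach.inv_of_pow_eq_one {k l : ℕ} {P : Perm (Fin m × Fin n)} (hP : Reach k P)
    (hl : 0 < l) (h : P ^ l = 1) : Reach ((l - 1) * k) P⁻¹ := by
  have : P⁻¹ = P ^ (l - 1) := by
    rw [inv_eq_iff_mul_eq_one, ← pow_succ', Nat.sub_add_cancel hl, h]
  rw [this]
  exact hP.pow _

theorem Reach.transpose {k : ℕ} {P : Perm (Fin m × Fin n)} (hP : Reach k P) :
    Reach k ((Equiv.prodComm (Fin m) (Fin n)).permCongr P) := by
  obtain ⟨S, rfl, h⟩ := hP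
  refine ⟨S.map Sum.swap, ?_, by simpa using h⟩
  clear h
  induction S with
  | nil => ext <;> simp
  | cons g S ih =>
    rw [List.map_cons, List.map_cons, List.map_cons, seqPerm_cons, seqPerm_cons, ih,
      Equiv.permCongr_mul]
    congr 1
    rcases g with i | j
    · ext ⟨a, b⟩ <;> simp [Move.toRotation, rotPerm]
    · ext ⟨a, b⟩ <;> simp [Move.toRotation, rotPerm]

theorem finRotate_pow_self {k : ℕ} (hk : 2 ≤ k) : finRotate k ^ k = 1 := by
  have h := (isCycle_finRotate_of_le hk).orderOf
  rw [support_finRotate_of_le hk, Finset.card_univ, Fintype.card_fin] at h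
  rw [orderOf_dvd_iff_pow_eq_one.symm, h]

theorem exists_finRotate_pow_eq {k : ℕ} (hk : 2 ≤ k) (i j : Fin k) :
    ∃ t < k, (finRotate k ^ t) i = j := by
  have hne : ∀ i, finRotate k i ≠ i := fun i => by
    rw [← mem_support, support_finRotate_of_le hk]; simp
  obtain ⟨t, ht⟩ := (isCycle_finRotate_of_le hk).exists_pow_eq (hne i) (hne j)
  exact ⟨t % k, Nat.mod_lt _ (by omega), by rw [← pow_eq_pow_mod t (finRotate_pow_self hk), ht]⟩

/-! ### Even permutations within the rows. -/

section Sorting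

variable (m) in
/-- The downward rotation of a set of columns. -/
def colsDown (J : Finset (Fin n)) : Perm (Fin m × Fin n) :=
  colHom fun j => if j ∈ J then finRotate m else 1

theorem colsDown_union {J K : Finset (Fin n)} (h : _root_.Disjoint J K) :
    colsDown m (J ∪ K) = colsDown m J * colsDown m K := by
  rw [colsDown, colsDown, colsDown, ← map_mul]
  congr 1
  ext1 j
  rw [Pi.mul_apply]
  by_cases hJ : j ∈ J
  · simp [hJ, Finset.disjoint_left.1 h hJ]
  · simp [hJ]

theorem reach_colsDown (J : Finset (Fin n)) : Reach J.card (colsDown m J) := by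
  induction J using Finset.induction_on with
  | empty =>
    have : colsDown m (∅ : Finset (Fin n)) = 1 := by ext <;> simp [colsDown]
    rw [this]; exact reach_one _
  | insert a J ha ih =>
    have : colsDown m {a} = rotPerm (Move.toRotation (Sum.inr a : Move m n)) := by
      rw [colsDown, Move.toRotation, rotPerm]
      congr 1
      ext1 j
      simp [Pi.mulSingle_apply]
    rw [Finset.insert_eq, colsDown_union (by simpa using ha),
      Finset.card_union_of_disjoint (by simpa using ha), this]
    exact (reach_move _).mul ih

variable (m n) in
/-- The downward rotation of all columns. -/
def allDown : Perm (Fin m × Fin n) := colsDown m Finset.univ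

theorem allDown_apply (x : Fin m × Fin n) : allDown m n x = (finRotate m x.1, x.2) := by
  simp [allDown, colsDown]

theorem allDown_pow_self (hm : 2 ≤ m) : allDown m n ^ m = 1 := by
  rw [allDown, colsDown, ← map_pow]
  have : (fun j : Fin n => if j ∈ Finset.univ then finRotate m else 1) ^ m = 1 := by
    ext1 j
    simp [finRotate_pow_self hm]
  rw [this, map_one]

theorem eq_rowHom_of_fst_eq {P : Perm (Fin m × Fin n)} (hP : ∀ x, (P x).1 = x.1) :
    ∃ π, P = rowHom π := by
  have hinj : ∀ r, Function.Bijective fun c => (P (r, c)).2 := by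
    intro r
    refine Finite.injective_iff_bijective.1 fun c c' h => ?_
    have : P (r, c) = P (r, c') := Prod.ext (by rw [hP, hP]) h
    exact congrArg Prod.snd (P.injective this)
  refine ⟨fun r => Equiv.ofBijective _ (hinj r), ?_⟩
  ext1 x
  exact Prod.ext (hP x) rfl

variable [NeZero m]

/-- The permutation of the grid that permutes its first row. -/
def row0 : Perm (Fin n) →* Perm (Fin m × Fin n) :=
  rowHom.comp (MonoidHom.mulSingle (fun _ : Fin m => Perm (Fin n)) 0)

theorem row0_eq (σ : Perm (Fin n)) :
    (row0 σ : Perm (Fin m × Fin n)) = rowHom (Pi.mulSingle 0 σ) := rfl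

theorem row0_apply_zero (σ : Perm (Fin n)) (j : Fin n) :
    row0 σ ((0 : Fin m), j) = (0, σ j) := by simp [row0_eq]

theorem row0_apply_ne (σ : Perm (Fin n)) {i : Fin m} (hi : i ≠ 0) (j : Fin n) :
    row0 σ (i, j) = (i, j) := by simp [row0_eq, hi]

theorem sign_row0 (σ : Perm (Fin n)) : sign (row0 σ : Perm (Fin m × Fin n)) = sign σ := by
  rw [← sign_prodExtendRight (0 : Fin m) σ]
  congr 1
  ext ⟨i, j⟩ : 1
  by_cases hi : i = 0
  · subst hi; rw [row0_apply_zero, prodExtendRight_apply_eq]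
  · rw [row0_apply_ne σ hi, prodExtendRight_apply_ne _ hi]

/-- One downward rotation of each column, performed in the course of one full revolution of the
first row, with an arbitrary matching between the entries of this row and the columns. -/
theorem reach_conj_allDown (hn : 2 ≤ n) (σ : Perm (Fin n)) :
    Reach (2 * n) ((row0 σ)⁻¹ * allDown m n * row0 σ) := by
  -- At time `t j` the entry that started in column `σ⁻¹ j` of the first row stands in column `j`,
  -- which is then pushed down.
  have : ∀ j, ∃ t < n, (finRotate n ^ t) (σ⁻¹ j) = j := fun j => exists_finRotate_pow_eq hn _ _
  choose t ht htj using this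
  have key : ∀ N, Reach (N + (Finset.univ.filter fun j => t j < N).card)
      (row0 (finRotate n) ^ N *
        ((row0 σ)⁻¹ * colsDown m (Finset.univ.filter fun j => t j < N) * row0 σ)) := by
    intro N
    induction N with
    | zero =>
      have : colsDown m (∅ : Finset (Fin n)) = 1 := by ext <;> simp [colsDown]
      simp [this, reach_one]
    | succ N ih =>
      set J := Finset.univ.filter fun j => t j < N
      set K := Finset.univ.filter fun j => t j = N
      have hKJ : _root_.Disjoint K J := by
        rw [Finset.disjoint_left]
        intro j hj hj'
        have h1 := (Finset.mem_filter.1 hj).2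
        have h2 := (Finset.mem_filter.1 hj').2
        omega
      have hunion : (Finset.univ.filter fun j => t j < N + 1) = K ∪ J := by
        ext j
        simp only [Finset.mem_filter, Finset.mem_univ, true_and, Finset.mem_union, J, K]
        omega
      -- At time `N` the slots due for the columns of `K` are exactly aligned with them, so the row
      -- permutation fixes these columns pointwise.
      have hdisj : Disjoint (row0 (finRotate n ^ N * σ⁻¹)) (colsDown m K) := by
        rintro ⟨i, j⟩
        by_cases hj : j ∈ K
        · left
          by_cases hi : i = 0
          · subst hi
            rw [row0_apply_zero, Perm.mul_apply, ← (Finset.mem_filter.1 hj).2, htj]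
          · rw [row0_apply_ne _ hi]
        · right
          simp [colsDown, hj]
      have hcomm := hdisj.commute.eq
      rw [map_mul, map_pow, map_inv] at hcomm
      have hR : row0 (finRotate n) = rotPerm (Move.toRotation (Sum.inl 0 : Move m n)) := rfl
      have heq : row0 (finRotate n) ^ (N + 1) *
          ((row0 σ)⁻¹ * colsDown m (K ∪ J) * row0 σ) =
          row0 (finRotate n) * (colsDown m K * (row0 (finRotate n) ^ N *
            ((row0 σ)⁻¹ * colsDown m J * row0 σ))) := by
        rw [colsDown_union hKJ, pow_succ']
        simp only [mul_assoc] at hcomm ⊢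
        rw [← mul_assoc (row0 σ)⁻¹ (colsDown m K), ← mul_assoc (row0 (finRotate n) ^ N), hcomm]
        simp only [mul_assoc]
      rw [hunion, Finset.card_union_of_disjoint hKJ, heq, hR]
      rw [hR] at ih
      exact ((reach_move _).mul ((reach_colsDown K).mul ih)).mono (by omega)
  have h := key n
  have huniv : (Finset.univ.filter fun j => t j < n) = Finset.univ := by simp [ht]
  rw [huniv, ← map_pow, finRotate_pow_self hn, map_one, one_mul, Finset.card_univ,
    Fintype.card_fin, ← two_mul] at h
  exact h

theorem allDown_conj_rowHom (π : Fin m → Perm (Fin n)) :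
    allDown m n * rowHom π * (allDown m n)⁻¹ = rowHom fun r => π ((finRotate m).symm r) := by
  rw [mul_inv_eq_iff_eq_mul]
  ext x : 1
  simp [allDown_apply]

/-- Arbitrary permutations of all rows but the first, at the expense of the first row. -/
theorem exists_reach_rowHom (hm : 2 ≤ m) (hn : 2 ≤ n) (π : Fin m → Perm (Fin n)) :
    ∃ ρ : Fin m → Perm (Fin n), Reach (2 * (m * n)) (rowHom ρ) ∧ sign (rowHom ρ) = 1 ∧
      ∀ r, r ≠ 0 → ρ r = π r := by
  have key : ∀ (k : ℕ) (π : Fin m → Perm (Fin n)), ∃ ρ : Fin m → Perm (Fin n),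
      Reach (k * (2 * n)) (rowHom ρ * allDown m n ^ k) ∧
      sign (rowHom ρ * allDown m n ^ k) = sign (allDown m n) ^ k ∧
      ∀ r : Fin m, r ≠ 0 → r.val < k → ρ r = π r := by
    intro k
    induction k with
    | zero => exact fun π => ⟨1, by simpa using reach_one _, by simp, by simp⟩
    | succ k ih =>
      intro π
      obtain ⟨ρ, h1, h2, h3⟩ := ih fun r => π (finRotate m r)
      -- The row about to leave the top carries `ρ 0`; this correction makes it arrive in the second
      -- row as prescribed. Rows already placed only shift down, hence the shifted `π` above.
      set s := π (finRotate m 0) * (ρ 0)⁻¹ with hs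
      set ρ' : Fin m → Perm (Fin n) := (Pi.mulSingle 0 s)⁻¹ *
        fun r => (Pi.mulSingle 0 s * ρ : Fin m → Perm (Fin n)) ((finRotate m).symm r) with hρ'
      have heq : rowHom ρ' * allDown m n ^ (k + 1) =
          ((row0 s)⁻¹ * allDown m n * row0 s) * (rowHom ρ * allDown m n ^ k) := by
        rw [hρ', map_mul, ← allDown_conj_rowHom, map_inv, map_mul, ← row0_eq, pow_succ']
        simp only [mul_assoc, inv_mul_cancel_left]
      refine ⟨ρ', ?_, ?_, ?_⟩
      · rw [heq, Nat.succ_mul, add_comm]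
        exact (reach_conj_allDown hn s).mul h1
      · rw [heq, Perm.sign_mul, h2, Perm.sign_mul, Perm.sign_mul, sign_inv, pow_succ',
          mul_right_comm (sign (row0 s)), Int.units_mul_self, one_mul]
      · intro r hr hrk
        obtain ⟨q, rfl⟩ := (finRotate m).surjective r
        have hq : q.val + 1 = (finRotate m q).val := by
          have := coe_finRotate_symm_of_ne_zero hr
          rw [symm_apply_apply] at this
          have : (finRotate m q).val ≠ 0 := fun h => hr (Fin.ext h)
          omega
        rw [hρ', Pi.mul_apply, Pi.inv_apply, Pi.mulSingle_eq_of_ne hr, inv_one, one_mul,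
          symm_apply_apply, Pi.mul_apply]
        by_cases hq0 : q = 0
        · subst hq0
          simp [hs]
        · rw [Pi.mulSingle_eq_of_ne hq0, one_mul, h3 q hq0 (by omega)]
  obtain ⟨ρ, h1, h2, h3⟩ := key m π
  -- After m pushes every row is back in its place, and a product of m conjugates of `allDown` has
  -- the sign of its m-th power, which is the identity.
  rw [allDown_pow_self hm, mul_one] at h1 h2
  rw [← map_pow, allDown_pow_self hm, map_one] at h2
  exact ⟨ρ, h1.mono (le_of_eq (by ring)), h2, fun r hr => h3 r hr r.isLt⟩

theorem second_row_commute_row0 (hm : 2 ≤ m) (δ σ : Perm (Fin n)) :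
    Commute (rowHom (Pi.mulSingle (finRotate m 0) δ) : Perm (Fin m × Fin n)) (row0 σ) := by
  rw [row0_eq]
  refine Commute.map (Pi.mulSingle_commute ?_ _ _) rowHom
  have : (0 : Fin m) ∈ (finRotate m).support := by
    rw [support_finRotate_of_le hm]; simp
  exact mem_support.1 this

/-- A permutation of the second row together with a conjugate of its inverse in the first. -/
theorem reach_second_row_mul_row0 (hm : 2 ≤ m) (hn : 2 ≤ n) (δ τ : Perm (Fin n)) :
    Reach (2 * (m * n)) (rowHom (Pi.mulSingle (finRotate m 0) δ) * row0 (τ⁻¹ * δ⁻¹ * τ)) := by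
  have hpow : ((row0 τ)⁻¹ * allDown m n * row0 τ) ^ m = 1 := by
    have h := conj_pow (i := m) (a := (row0 τ)⁻¹) (b := allDown m n)
    rw [inv_inv] at h
    rw [h, allDown_pow_self hm, mul_one, inv_mul_cancel]
  -- One push followed by the inverse of another, where the inverse counts as m − 1 pushes: 2mn
  -- moves in all. The second factor acts first.
  have h := (reach_conj_allDown (m := m) hn (δ * τ)).mul
    ((reach_conj_allDown hn τ).inv_of_pow_eq_one (by omega) hpow)
  have hA : (rowHom (Pi.mulSingle (finRotate m 0) δ) : Perm (Fin m × Fin n)) =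
      allDown m n * row0 δ * (allDown m n)⁻¹ := by
    rw [row0_eq, allDown_conj_rowHom]
    congr 1
    ext1 r
    rw [Pi.mulSingle_apply, Pi.mulSingle_apply]
    exact if_congr ((finRotate m).symm_apply_eq).symm rfl rfl
  have hcomm := (second_row_commute_row0 hm δ (τ⁻¹ * δ⁻¹)).eq
  have heq : rowHom (Pi.mulSingle (finRotate m 0) δ) * row0 (τ⁻¹ * δ⁻¹ * τ) =
      ((row0 (δ * τ))⁻¹ * allDown m n * row0 (δ * τ)) *
        ((row0 τ)⁻¹ * allDown m n * row0 τ)⁻¹ := by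
    rw [map_mul, ← mul_assoc, hcomm, hA]
    simp only [map_mul, map_inv, mul_inv_rev, inv_inv, mul_assoc, mul_inv_cancel_left]
  rw [heq]
  refine h.mono (le_of_eq ?_)
  obtain ⟨k, rfl⟩ : ∃ k, m = k + 1 := ⟨m - 1, by omega⟩
  simp only [Nat.add_sub_cancel]
  ring

/-- The second row serves as workspace: it undergoes `δ⁻¹` and then `δ`, while the first row gets δ
conjugated by τ, then `δ⁻¹`. Each of the two commutators costs 2mn + 2mn. -/
theorem reach_row0 (hm : 2 ≤ m) (hn : 2 ≤ n) (ε : Perm (Fin n)) (hε : sign ε = 1) :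
    Reach (8 * (m * n)) (row0 ε : Perm (Fin m × Fin n)) := by
  have key : ∀ δ τ : Perm (Fin n),
      Reach (4 * (m * n)) (row0 (δ⁻¹ * (τ⁻¹ * δ * τ)) : Perm (Fin m × Fin n)) := by
    intro δ τ
    have h := (reach_second_row_mul_row0 hm hn δ 1).mul (reach_second_row_mul_row0 hm hn δ⁻¹ τ)
    have heq : rowHom (Pi.mulSingle (finRotate m 0) δ) * row0 (1⁻¹ * δ⁻¹ * 1) *
        (rowHom (Pi.mulSingle (finRotate m 0) δ⁻¹) * row0 (τ⁻¹ * δ⁻¹⁻¹ * τ)) =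
        (row0 (δ⁻¹ * (τ⁻¹ * δ * τ)) : Perm (Fin m × Fin n)) := by
      rw [inv_one, one_mul, mul_one, inv_inv, map_mul row0 δ⁻¹, mul_assoc,
        ← mul_assoc (row0 δ⁻¹), ← (second_row_commute_row0 hm δ⁻¹ δ⁻¹).eq, ← mul_assoc,
        ← mul_assoc, ← map_mul rowHom, ← Pi.mulSingle_mul, mul_inv_cancel, Pi.mulSingle_one,
        map_one, one_mul]
    rw [heq] at h
    exact h.mono (by omega)
  obtain ⟨δ, τ, δ', τ', rfl⟩ := exists_conj_mul_of_sign_eq_one ε hε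
  rw [map_mul]
  exact ((key δ τ).mul (key δ' τ')).mono (by omega)

/-- The gadgets settle all rows but the first by an even permutation, so the correction left in the
first row is even as well. -/
theorem reach_of_fst_eq (hm : 2 ≤ m) (hn : 2 ≤ n) {P : Perm (Fin m × Fin n)}
    (hP : ∀ x, (P x).1 = x.1) (hs : sign P = 1) : Reach (10 * (m * n)) P := by
  obtain ⟨π, rfl⟩ := eq_rowHom_of_fst_eq hP
  obtain ⟨ρ, h1, h2, h3⟩ := exists_reach_rowHom hm hn π
  have heq : rowHom π = row0 (π 0 * (ρ 0)⁻¹) * rowHom ρ := by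
    rw [row0_eq, ← map_mul]
    congr 1
    ext1 r
    by_cases hr : r = 0
    · subst hr; simp
    · rw [Pi.mul_apply, Pi.mulSingle_eq_of_ne hr, one_mul, h3 r hr]
  have hε : sign (π 0 * (ρ 0)⁻¹) = 1 := by
    rw [heq, Perm.sign_mul, h2, mul_one, sign_row0] at hs
    exact hs
  rw [heq]
  exact ((reach_row0 hm hn _ hε).mul h1).mono (by omega)

end Sorting

/-! ### Parity, and arbitrary permutations of the grid. -/

section

theorem reach_of_snd_eq (hm : 2 ≤ m) (hn : 2 ≤ n) {P : Perm (Fin m × Fin n)}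
    (hP : ∀ x, (P x).2 = x.2) (hs : sign P = 1) : Reach (10 * (m * n)) P := by
  have : NeZero n := ⟨by omega⟩
  have h := (reach_of_fst_eq hn hm (P := (Equiv.prodComm (Fin m) (Fin n)).permCongr P)
    (fun x => by simp [hP]) (by rw [sign_permCongr, hs])).transpose
  rw [mul_comm n m] at h
  convert h using 1
  ext1 x
  simp

/-- Every even permutation obtained from `P` by multiplying it by `τ` on the left, on the right,
on both sides or not at all is effected by at most `k` moves. -/
def ReachUpTo (τ : Perm (Fin m × Fin n)) (k : ℕ) (P : Perm (Fin m × Fin n)) : Prop :=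
  ∀ s t : Perm (Fin m × Fin n), (s = 1 ∨ s = τ) → (t = 1 ∨ t = τ) →
    sign (s * P * t) = 1 → Reach k (s * P * t)

theorem ReachUpTo.mul {τ P Q : Perm (Fin m × Fin n)} {k l : ℕ} (hττ : τ * τ = 1)
    (hτ : sign τ = -1) (hP : ReachUpTo τ k P) (hQ : ReachUpTo τ l Q) :
    ReachUpTo τ (k + l) (P * Q) := by
  intro s t hs ht h
  -- Inserting `u * u = 1` between the factors makes both of them even.
  obtain ⟨u, hu, hsu⟩ : ∃ u, (u = 1 ∨ u = τ) ∧ sign (s * P * u) = 1 := by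
    rcases Int.units_eq_one_or (sign (s * P)) with h1 | h1
    · exact ⟨1, Or.inl rfl, by rw [mul_one, h1]⟩
    · exact ⟨τ, Or.inr rfl, by rw [Perm.sign_mul, h1, hτ]; rfl⟩
  have huu : u * u = 1 := by
    rcases hu with rfl | rfl
    · exact one_mul 1
    · exact hττ
  have heq : s * (P * Q) * t = (s * P * u) * (u * Q * t) := by
    calc s * (P * Q) * t = s * P * 1 * Q * t := by simp only [mul_assoc, one_mul]
      _ = _ := by rw [← huu]; simp only [mul_assoc]
  rw [heq] at h ⊢
  rw [Perm.sign_mul, hsu, one_mul] at h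
  exact (hP s u hs hu hsu).mul (hQ u t hu ht h)

theorem reach_of_sign_eq_one (hm : 2 ≤ m) (hn : 2 ≤ n) {P : Perm (Fin m × Fin n)}
    (hs : sign P = 1) : Reach (32 * (m * n)) P := by
  have : NeZero m := ⟨by omega⟩
  have : NeZero n := ⟨by omega⟩
  have hfix : ∀ {k : ℕ}, 2 ≤ k → ∀ i : Fin k, finRotate k i ≠ i := fun hk i => by
    rw [← mem_support, support_finRotate_of_le hk]; simp
  set R : Perm (Fin m × Fin n) := rotPerm (Move.toRotation (Sum.inl 0)) with hR
  set D : Perm (Fin m × Fin n) := rotPerm (Move.toRotation (Sum.inr 0)) with hD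
  have hRap : ∀ i j, R (i, j) = if i = 0 then (i, finRotate n j) else (i, j) := by
    intro i j
    by_cases h : i = 0
    · subst h; simp [hR, Move.toRotation, rotPerm]
    · simp [hR, Move.toRotation, rotPerm, h]
  have hDap : ∀ i j, D (i, j) = if j = 0 then (finRotate m i, j) else (i, j) := by
    intro i j
    by_cases h : j = 0
    · subst h; simp [hD, Move.toRotation, rotPerm]
    · simp [hD, Move.toRotation, rotPerm, h]
  set a : Fin m × Fin n := (0, 0) with ha
  have hRa : R a = (0, finRotate n 0) := by rw [ha, hRap, if_pos rfl]
  have hDa : D a = (finRotate m 0, 0) := by rw [ha, hDap, if_pos rfl]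
  have hRne : R a ≠ a := fun h => hfix hn 0 (by rw [hRa] at h; exact congrArg Prod.snd h)
  have hDne : D a ≠ a := fun h => hfix hm 0 (by rw [hDa] at h; exact congrArg Prod.fst h)
  have hmeet : ∀ x, R x ≠ x → D x ≠ x → x = a := by
    rintro ⟨i, j⟩ h1 h2
    rw [hRap] at h1
    rw [hDap] at h2
    have hi : i = 0 := by by_contra h; exact h1 (if_neg h)
    have hj : j = 0 := by by_contra h; exact h2 (if_neg h)
    rw [hi, hj]
  have hRn : R ^ n = 1 := by
    rw [hR, Move.toRotation, rotPerm, ← map_pow, ← Pi.mulSingle_pow, finRotate_pow_self hn,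
      Pi.mulSingle_one, map_one]
  have hDm : D ^ m = 1 := by
    rw [hD, Move.toRotation, rotPerm, ← map_pow, ← Pi.mulSingle_pow, finRotate_pow_self hm,
      Pi.mulSingle_one, map_one]
  have rR : Reach 1 R := reach_move _
  have rD : Reach 1 D := reach_move _
  have rR' := rR.inv_of_pow_eq_one (by omega) hRn
  have rD' := rD.inv_of_pow_eq_one (by omega) hDm
  have hmn : m + n ≤ m * n := by nlinarith
  set τ := swap a (R a) with hτ
  set υ := swap a (D a) with hυ
  -- The commutator of a row move and a column move costs 1 + 1 + (n − 1) + (m − 1) = m + n moves.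
  have h1 : Reach (m * n) (υ * τ) := by
    rw [hυ, hτ, ← commutator_eq_swap_mul_swap R D a hmeet hRne hDne]
    exact (((rR.mul rD).mul rR').mul rD').mono (by omega)
  have h2 : Reach (m * n) (τ * υ) := by
    rw [hυ, hτ, ← commutator_eq_swap_mul_swap D R a (fun x h h' => hmeet x h' h) hDne hRne]
    exact (((rD.mul rR).mul rD').mul rR').mono (by omega)
  have hττ : τ * τ = 1 := by simp [hτ]
  have hυυ : υ * υ = 1 := by simp [hυ]
  have hsτ : sign τ = -1 := sign_swap (Ne.symm hRne)
  have hsυ : sign υ = -1 := sign_swap (Ne.symm hDne)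
  have hτrow : ∀ x, (τ x).1 = x.1 := by
    intro x
    rw [hτ, swap_apply_def]
    split_ifs with h h
    · rw [h, hRa]
    · rw [h, hRa]
    · rfl
  have hυcol : ∀ x, (υ x).2 = x.2 := by
    intro x
    rw [hυ, swap_apply_def]
    split_ifs with h h
    · rw [h, hDa]
    · rw [h, hDa]
    · rfl
  have hrow : ∀ ρ : Perm (Fin m × Fin n), (∀ x, (ρ x).1 = x.1) →
      ReachUpTo τ (10 * (m * n)) ρ := by
    intro ρ hρ s t hs ht h
    refine reach_of_fst_eq hm hn (fun x => ?_) h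
    have aux : ∀ u : Perm (Fin m × Fin n), (u = 1 ∨ u = τ) → ∀ x, (u x).1 = x.1 := by
      rintro u (rfl | rfl) x
      · rfl
      · exact hτrow x
    rw [Perm.mul_apply, Perm.mul_apply, aux s hs, hρ, aux t ht]
  -- `τ` does not preserve columns, so it is traded for `υ` on either side at a cost of mn each: 10
  -- + 1 + 1 = 12.
  have hcol : ∀ κ : Perm (Fin m × Fin n), (∀ x, (κ x).2 = x.2) →
      ReachUpTo τ (12 * (m * n)) κ := by
    intro κ hκ s t hs ht h
    have aux : ∀ u : Perm (Fin m × Fin n), (u = 1 ∨ u = τ) → ∃ u', u' * u' = 1 ∧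
        (∀ x, (u' x).2 = x.2) ∧ sign u = sign u' ∧ Reach (m * n) (u * u') ∧
        Reach (m * n) (u' * u) := by
      rintro u (rfl | rfl)
      · exact ⟨1, by simp, by simp, rfl, reach_one _, reach_one _⟩
      · exact ⟨υ, hυυ, hυcol, by rw [hsτ, hsυ], h2, h1⟩
    obtain ⟨s', hs1, hs2, hs3, hs4, -⟩ := aux s hs
    obtain ⟨t', ht1, ht2, ht3, -, ht4⟩ := aux t ht
    have heq : s * κ * t = (s * s') * (s' * κ * t') * (t' * t) := by
      calc s * κ * t = s * 1 * κ * 1 * t := by simp only [mul_assoc, one_mul]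
        _ = s * (s' * s') * κ * (t' * t') * t := by rw [hs1, ht1]
        _ = _ := by simp only [mul_assoc]
    have hsign : sign (s' * κ * t') = 1 := by
      rw [Perm.sign_mul, Perm.sign_mul, ← hs3, ← ht3, ← Perm.sign_mul, ← Perm.sign_mul, h]
    rw [heq]
    refine ((hs4.mul (reach_of_snd_eq hm hn (fun x => ?_) hsign)).mul ht4).mono (by omega)
    rw [Perm.mul_apply, Perm.mul_apply, hs2, hκ, ht2]
  obtain ⟨ρ, κ, ρ', rfl, h3, h4, h5⟩ := exists_row_column_row P
  have := (((hrow ρ h3).mul hττ hsτ (hcol κ h4)).mul hττ hsτ (hrow ρ' h5)) 1 1 (Or.inl rfl)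
    (Or.inl rfl)
  rw [one_mul, mul_one] at this
  exact (this hs).mono (by omega)

theorem exists_odd_move (S : List (Rotation m n)) (hS : sign (seqPerm S) ≠ 1) :
    ∃ g : Move m n, sign (rotPerm g.toRotation) = -1 := by
  by_contra! h
  have h' : ∀ g : Move m n, sign (rotPerm g.toRotation) = 1 := fun g =>
    (Int.units_eq_one_or _).resolve_right (h g)
  have hr : ∀ r : Rotation m n, sign (rotPerm r) = 1 := by
    rintro (i | i | j | j)
    · exact h' (.inl i)
    · rw [rotPerm, sign_inv]; exact h' (.inl i)
    · exact h' (.inr j)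
    · rw [rotPerm, sign_inv]; exact h' (.inr j)
  apply hS
  induction S with
  | nil => simp
  | cons r S ih =>
    rw [seqPerm_cons, Perm.sign_mul, hr, mul_one]
    by_contra hc
    exact hc (ih hc)

/-- An odd permutation can arise only if some move is odd; performing that move first leaves an even
permutation. -/
theorem reach_seqPerm (hm : 2 ≤ m) (hn : 2 ≤ n) (S : List (Rotation m n)) :
    Reach (33 * (m * n)) (seqPerm S) := by
  by_cases hS : sign (seqPerm S) = 1
  · exact (reach_of_sign_eq_one hm hn hS).mono (by omega)
  · obtain ⟨g, hg⟩ := exists_odd_move S hS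
    have h := (Int.units_eq_one_or _).resolve_left hS
    have h1 : sign (seqPerm S * (rotPerm g.toRotation)⁻¹) = 1 := by
      rw [Perm.sign_mul, sign_inv, h, hg]; rfl
    have h2 := (reach_of_sign_eq_one hm hn h1).mul (reach_move g)
    rw [inv_mul_cancel_right] at h2
    exact h2.mono (by nlinarith)

/-- A sortable matrix is sorted by linearly many rightward and downward rotations. -/
theorem exists_moves_of_sortable (hm : 2 ≤ m) (hn : 2 ≤ n) (A : Matrix (Fin m) (Fin n) ℕ)
    (hA : Sortable A) :
    ∃ S : List (Move m n), Sorts (S.map Move.toRotation) A ∧ S.length ≤ 33 * (m * n) := by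
  obtain ⟨T, hT⟩ := hA
  obtain ⟨S, h1, h2⟩ := reach_seqPerm hm hn T
  refine ⟨S, ?_, h2⟩
  rw [Sorts] at hT ⊢
  rw [← hT]
  ext i j
  have := applySeq_apply A (S.map Move.toRotation) (i, j)
  rw [h1, ← applySeq_apply A T (i, j)] at this
  exact this

end

/-! ### Exhaustive search and its computability. -/

section BruteForce

/-- The words of length at most `k` over an alphabet. -/
def wordsUpTo {α : Type*} (l : List α) (k : ℕ) : List (List α) :=
  Nat.rec [[]] (fun _ W => W ++ W.flatMap fun w => l.map fun x => x :: w) k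

theorem mem_wordsUpTo {α : Type*} {l : List α} {k : ℕ} {w : List α} :
    w ∈ wordsUpTo l k ↔ w.length ≤ k ∧ ∀ x ∈ w, x ∈ l := by
  induction k generalizing w with
  | zero =>
    rw [show wordsUpTo l 0 = [[]] from rfl, List.mem_singleton, Nat.le_zero,
      List.length_eq_zero_iff]
    constructor
    · rintro rfl; simp
    · exact fun h => h.1
  | succ k ih =>
    have : wordsUpTo l (k + 1) =
      wordsUpTo l k ++ (wordsUpTo l k).flatMap fun w => l.map fun x => x :: w := rfl
    rw [this, List.mem_append, ih, List.mem_flatMap]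
    constructor
    · rintro (h | ⟨v, hv, hw⟩)
      · exact ⟨h.1.trans k.le_succ, h.2⟩
      · obtain ⟨x, hx, rfl⟩ := List.mem_map.1 hw
        rw [ih] at hv
        refine ⟨Nat.succ_le_succ hv.1, ?_⟩
        intro y hy
        rcases List.mem_cons.1 hy with rfl | hy
        · exact hx
        · exact hv.2 y hy
    · rintro ⟨h1, h2⟩
      rcases w with _ | ⟨x, w⟩
      · left; simp
      · right
        refine ⟨w, ih.2 ⟨Nat.le_of_succ_le_succ h1, fun y hy => h2 y (List.mem_cons_of_mem _ hy)⟩,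
          List.mem_map.2 ⟨x, h2 x List.mem_cons_self, rfl⟩⟩

theorem primrec_wordsUpTo {α : Type*} [Primcodable α] :
    Primrec₂ (wordsUpTo : List α → ℕ → List (List α)) := by
  refine Primrec.nat_rec (f := fun _ : List α => [[]])
    (g := fun l p => p.2 ++ p.2.flatMap fun w => l.map fun x => x :: w) (Primrec.const _) ?_
  refine Primrec.list_append.comp (Primrec.snd.comp Primrec.snd)
    (Primrec.list_flatMap (Primrec.snd.comp Primrec.snd) ?_)
  exact Primrec.list_map (Primrec.fst.comp Primrec.fst)
    (Primrec.list_cons.comp Primrec.snd (Primrec.snd.comp Primrec.fst))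

/-- The position, in a grid of the given dimensions, from which a move brings an entry to `p`. -/
def prevPos (d : ℕ × ℕ) (g : ℕ ⊕ ℕ) (p : ℕ × ℕ) : ℕ × ℕ :=
  -- The modulus is added before 1 is subtracted, so that column 0 wraps around despite truncated
  -- subtraction.
  Sum.casesOn g (fun i => if p.1 = i then (p.1, (p.2 + d.2 - 1) % d.2) else p)
    (fun j => if p.2 = j then ((p.1 + d.1 - 1) % d.1, p.2) else p)

theorem primrec_prevPos :
    Primrec fun a : (ℕ × ℕ) × ((ℕ ⊕ ℕ) × (ℕ × ℕ)) => prevPos a.1 a.2.1 a.2.2 := by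
  have hrot : Primrec₂ fun x k : ℕ => (x + k - 1) % k :=
    Primrec.nat_mod.comp (Primrec.nat_sub.comp (Primrec.nat_add.comp Primrec.fst Primrec.snd)
      (Primrec.const 1)) Primrec.snd
  have hp : Primrec fun b : ((ℕ × ℕ) × ((ℕ ⊕ ℕ) × (ℕ × ℕ))) × ℕ => b.1.2.2 :=
    Primrec.snd.comp (Primrec.snd.comp Primrec.fst)
  have hd : Primrec fun b : ((ℕ × ℕ) × ((ℕ ⊕ ℕ) × (ℕ × ℕ))) × ℕ => b.1.1 :=
    Primrec.fst.comp Primrec.fst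
  refine Primrec.sumCasesOn (Primrec.fst.comp Primrec.snd) ?_ ?_
  · refine Primrec.ite (Primrec.eq.comp (Primrec.fst.comp hp) Primrec.snd)
      (Primrec.pair (Primrec.fst.comp hp) ?_) hp
    exact hrot.comp (Primrec.snd.comp hp) (Primrec.snd.comp hd)
  · refine Primrec.ite (Primrec.eq.comp (Primrec.snd.comp hp) Primrec.snd)
      (Primrec.pair ?_ (Primrec.snd.comp hp)) hp
    exact hrot.comp (Primrec.fst.comp hp) (Primrec.fst.comp hd)

/-- The position from which a sequence of moves brings an entry to `p`. -/
def sourcePos (d : ℕ × ℕ) (w : List (ℕ ⊕ ℕ)) (p : ℕ × ℕ) : ℕ × ℕ := w.foldr (prevPos d) p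

/-- The dimensions of a matrix given by the list of its rows. -/
def dims (L : List (List ℕ)) : ℕ × ℕ := (L.length, L.headI.length)

theorem primrec_dims : Primrec dims :=
  Primrec.pair Primrec.list_length (Primrec.list_length.comp Primrec.list_headI)

/-- The entry that a sequence of moves brings to the position numbered `x` in reading order. -/
def finalEntry (L : List (List ℕ)) (w : List (ℕ ⊕ ℕ)) (x : ℕ) : ℕ :=
  (L.getD (sourcePos (dims L) w (x / (dims L).2, x % (dims L).2)).1 []).getD
    (sourcePos (dims L) w (x / (dims L).2, x % (dims L).2)).2 0

theorem primrec_finalEntry :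
    Primrec fun a : List (List ℕ) × List (ℕ ⊕ ℕ) × ℕ => finalEntry a.1 a.2.1 a.2.2 := by
  have hL : Primrec fun a : List (List ℕ) × List (ℕ ⊕ ℕ) × ℕ => a.1 := Primrec.fst
  have hd := primrec_dims.comp hL
  have hx : Primrec fun a : List (List ℕ) × List (ℕ ⊕ ℕ) × ℕ => a.2.2 :=
    Primrec.snd.comp Primrec.snd
  have hs : Primrec fun a : List (List ℕ) × List (ℕ ⊕ ℕ) × ℕ =>
      sourcePos (dims a.1) a.2.1 (a.2.2 / (dims a.1).2, a.2.2 % (dims a.1).2) := by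
    refine Primrec.list_foldr (h := fun a p => prevPos (dims a.1) p.1 p.2)
      (Primrec.fst.comp Primrec.snd) (Primrec.pair
      (Primrec.nat_div.comp hx (Primrec.snd.comp hd))
      (Primrec.nat_mod.comp hx (Primrec.snd.comp hd))) ?_
    exact primrec_prevPos.comp (Primrec.pair (hd.comp Primrec.fst) Primrec.snd)
  exact (Primrec.list_getD 0).comp ((Primrec.list_getD []).comp hL (Primrec.fst.comp hs))
    (Primrec.snd.comp hs)

/-- The sequence of moves `w` sorts the matrix with the list of rows `L`. -/
def IsSolution (w : List (ℕ ⊕ ℕ)) (L : List (List ℕ)) : Prop :=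
  ∀ x ∈ List.range ((dims L).1 * (dims L).2), finalEntry L w x = x + 1

instance : DecidableRel IsSolution := fun _ _ => by unfold IsSolution; infer_instance

theorem primrecRel_isSolution : PrimrecRel IsSolution := by
  have h : PrimrecRel fun (x : ℕ) (b : List (ℕ ⊕ ℕ) × List (List ℕ)) =>
      finalEntry b.2 b.1 x = x + 1 :=
    Primrec.eq.comp (primrec_finalEntry.comp (Primrec.pair (Primrec.snd.comp Primrec.snd)
      (Primrec.pair (Primrec.fst.comp Primrec.snd) Primrec.fst))) (Primrec.succ.comp Primrec.fst)
  exact h.forall_mem_list.comp (Primrec.list_range.comp (Primrec.nat_mul.comp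
    (Primrec.fst.comp (primrec_dims.comp Primrec.snd))
    (Primrec.snd.comp (primrec_dims.comp Primrec.snd)))) Primrec.id

/-- All moves of a grid of the given dimensions. -/
def allMoves (d : ℕ × ℕ) : List (ℕ ⊕ ℕ) :=
  (List.range d.1).map Sum.inl ++ (List.range d.2).map Sum.inr

theorem primrec_allMoves : Primrec allMoves :=
  Primrec.list_append.comp
    (Primrec.list_map (Primrec.list_range.comp Primrec.fst) (Primrec.sumInl.comp Primrec.snd))
    (Primrec.list_map (Primrec.list_range.comp Primrec.snd) (Primrec.sumInr.comp Primrec.snd))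

/-- A shortest solution among the sequences of linearly bounded length. -/
def bruteForce (L : List (List ℕ)) : List (ℕ ⊕ ℕ) :=
  ((wordsUpTo (allMoves (dims L)) (33 * ((dims L).1 * (dims L).2))).filter
    fun w => IsSolution w L).headI

theorem primrec_bruteForce : Primrec bruteForce := by
  refine Primrec.list_headI.comp (primrecRel_isSolution.listFilter.comp
    (primrec_wordsUpTo.comp (primrec_allMoves.comp primrec_dims) ?_) Primrec.id)
  exact Primrec.nat_mul.comp (Primrec.const 33) (Primrec.nat_mul.comp
    (Primrec.fst.comp primrec_dims) (Primrec.snd.comp primrec_dims))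

theorem dims_encodeMatrix (hm : 0 < m) (A : Matrix (Fin m) (Fin n) ℕ) :
    dims (encodeMatrix A) = (m, n) := by
  obtain ⟨k, rfl⟩ : ∃ k, m = k + 1 := ⟨m - 1, by omega⟩
  simp [dims, encodeMatrix, List.ofFn_succ]

theorem finRotate_symm_val {k : ℕ} (i : Fin k) :
    ((finRotate k).symm i).val = (i.val + k - 1) % k := by
  obtain ⟨j, rfl⟩ := (finRotate k).surjective i
  rw [symm_apply_apply]
  obtain ⟨l, rfl⟩ : ∃ l, k = l + 1 := ⟨k - 1, by have := j.isLt; omega⟩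
  rw [coe_finRotate]
  split_ifs with h
  · subst h; simp
  · rw [show j.val + 1 + (l + 1) - 1 = j.val + (l + 1) by omega, Nat.add_mod_right,
      Nat.mod_eq_of_lt j.isLt]

theorem prevPos_eq (g : Move m n) (x : Fin m × Fin n) :
    prevPos (m, n) (Sum.map Fin.val Fin.val g) (x.1, x.2) =
      ((((rotPerm g.toRotation)⁻¹ x).1 : ℕ), (((rotPerm g.toRotation)⁻¹ x).2 : ℕ)) := by
  obtain ⟨i, j⟩ := x
  rcases g with i' | j'
  · rw [Move.toRotation, rotPerm, ← map_inv, ← Pi.mulSingle_inv]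
    by_cases h : i = i'
    · subst h
      have := finRotate_symm_val j
      simp [prevPos, ← this]
    · simp [prevPos, h, Fin.val_inj]
  · rw [Move.toRotation, rotPerm, ← map_inv, ← Pi.mulSingle_inv]
    by_cases h : j = j'
    · subst h
      have := finRotate_symm_val i
      simp [prevPos, ← this]
    · simp [prevPos, h, Fin.val_inj]

/-- Tracing an entry back undoes the last move first, which is the order of `foldr`. -/
theorem sourcePos_encodeMoves (S : List (Move m n)) (x : Fin m × Fin n) :
    sourcePos (m, n) (encodeMoves S) (x.1, x.2) =
      ((((seqPerm (S.map Move.toRotation))⁻¹ x).1 : ℕ),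
        (((seqPerm (S.map Move.toRotation))⁻¹ x).2 : ℕ)) := by
  induction S with
  | nil => rfl
  | cons g S ih =>
    rw [List.map_cons, seqPerm_cons, mul_inv_rev, Perm.mul_apply, ← prevPos_eq, ← ih]
    rfl

theorem finalEntry_encode (hm : 0 < m) (A : Matrix (Fin m) (Fin n) ℕ) (S : List (Move m n))
    (i : Fin m) (j : Fin n) :
    finalEntry (encodeMatrix A) (encodeMoves S) (i * n + j) =
      applySeq A (S.map Move.toRotation) i j := by
  have hn : 0 < n := j.pos
  have h1 : ((i : ℕ) * n + j) / n = i := by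
    rw [mul_comm, Nat.mul_add_div hn, Nat.div_eq_of_lt j.isLt, add_zero]
  have h2 : ((i : ℕ) * n + j) % n = j := by
    rw [mul_comm, Nat.mul_add_mod, Nat.mod_eq_of_lt j.isLt]
  rw [finalEntry, dims_encodeMatrix hm, h1, h2, sourcePos_encodeMoves S (i, j),
    applySeq_apply A _ (i, j)]
  simp [encodeMatrix, List.getD_eq_getElem?_getD]

theorem isSolution_encode_iff (hm : 0 < m) (A : Matrix (Fin m) (Fin n) ℕ) (S : List (Move m n)) :
    IsSolution (encodeMoves S) (encodeMatrix A) ↔ Sorts (S.map Move.toRotation) A := by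
  rw [IsSolution, dims_encodeMatrix hm, Sorts]
  constructor
  · intro h
    ext i j
    rw [← finalEntry_encode hm, h]
    · rfl
    · rw [List.mem_range]
      have := i.isLt
      have := j.isLt
      nlinarith
  · intro h x hx
    rw [List.mem_range] at hx
    have hn : 0 < n := Nat.pos_of_ne_zero (by rintro rfl; simp at hx)
    have := finalEntry_encode hm A S ⟨x / n, Nat.div_lt_of_lt_mul (by rwa [mul_comm])⟩
      ⟨x % n, Nat.mod_lt _ hn⟩
    rw [h] at this
    simpa [sorted, Nat.div_add_mod'] using this

theorem exists_encodeMoves_eq {w : List (ℕ ⊕ ℕ)} (hw : ∀ g ∈ w, g ∈ allMoves (m, n)) :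
    ∃ S : List (Move m n), w = encodeMoves S := by
  induction w with
  | nil => exact ⟨[], rfl⟩
  | cons g w ih =>
    obtain ⟨S, rfl⟩ := ih fun g' hg' => hw g' (List.mem_cons_of_mem _ hg')
    have hg := hw g List.mem_cons_self
    simp only [allMoves, List.mem_append, List.mem_map, List.mem_range] at hg
    rcases hg with ⟨i, hi, rfl⟩ | ⟨j, hj, rfl⟩
    · exact ⟨Sum.inl ⟨i, hi⟩ :: S, rfl⟩
    · exact ⟨Sum.inr ⟨j, hj⟩ :: S, rfl⟩

theorem encodeMoves_mem_allMoves (S : List (Move m n)) :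
    ∀ g ∈ encodeMoves S, g ∈ allMoves (m, n) := by
  intro g hg
  obtain ⟨g, -, rfl⟩ := List.mem_map.1 hg
  rcases g with i | j <;> simp [allMoves]

/-- On a sortable matrix the search finds a solution of linearly bounded length. -/
theorem bruteForce_spec (hm : 2 ≤ m) (hn : 2 ≤ n) (A : Matrix (Fin m) (Fin n) ℕ)
    (hA : Sortable A) :
    ∃ S : List (Move m n), bruteForce (encodeMatrix A) = encodeMoves S ∧
      Sorts (S.map Move.toRotation) A ∧ S.length ≤ 33 * (m * n) := by
  obtain ⟨T, hT, hlen⟩ := exists_moves_of_sortable hm hn A hA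
  have hm' : 0 < m := by omega
  have hmem : bruteForce (encodeMatrix A) ∈ (wordsUpTo (allMoves (m, n)) (33 * (m * n))).filter
      fun w => IsSolution w (encodeMatrix A) := by
    rw [bruteForce, dims_encodeMatrix hm']
    have hT' : encodeMoves T ∈ (wordsUpTo (allMoves (m, n)) (33 * (m * n))).filter
        fun w => IsSolution w (encodeMatrix A) := by
      rw [List.mem_filter, mem_wordsUpTo, decide_eq_true_eq, isSolution_encode_iff hm']
      exact ⟨⟨by simpa [encodeMoves] using hlen, encodeMoves_mem_allMoves T⟩, hT⟩
    -- The encoding of `T` shows that the filtered list is nonempty, so `headI` returns a member of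
    -- it and not its default.
    revert hT'
    generalize (wordsUpTo (allMoves (m, n)) (33 * (m * n))).filter
        (fun w => IsSolution w (encodeMatrix A)) = l
    rcases l with _ | ⟨a, l⟩
    · simp
    · simp
  rw [List.mem_filter, mem_wordsUpTo, decide_eq_true_eq] at hmem
  obtain ⟨⟨h1, h2⟩, h3⟩ := hmem
  obtain ⟨S, hS⟩ := exists_encodeMoves_eq h2
  rw [hS] at h1 h3
  exact ⟨S, hS, (isSolution_encode_iff hm' A S).1 h3, by simpa [encodeMoves] using h1⟩

end BruteForce

end TorusPuzzle

open TorusPuzzle in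
theorem mainTheorem1 :
    ∃ (C : ℝ) (alg : List (List ℕ) → List (ℕ ⊕ ℕ)), Computable alg ∧
      ∀ (m n : ℕ), 2 ≤ m → 2 ≤ n →
        ∀ A : Matrix (Fin m) (Fin n) ℕ, IsInstance A → Sortable A →
          (∃ S : List (Move m n),
            alg (encodeMatrix A) = encodeMoves S ∧
            Sorts (S.map Move.toRotation) A ∧
            (S.length : ℝ) ≤ C * ((m : ℝ) * (n : ℝ) * Real.log (max (m : ℝ) (n : ℝ)))) ∧
          (pushNumber A : ℝ) ≤ C * ((m : ℝ) * (n : ℝ) * Real.log (max (m : ℝ) (n : ℝ))) := by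
  -- 66 = 33 · 2, since log max{m,n} ≥ log 2 > 1/2.
  refine ⟨66, bruteForce, primrec_bruteForce.to_comp, ?_⟩
  intro m n hm hn A _ hA
  obtain ⟨S, h1, h2, h3⟩ := bruteForce_spec hm hn A hA
  have hlog : 1 / 2 ≤ Real.log (max (m : ℝ) (n : ℝ)) := by
    have h2m : (2 : ℝ) ≤ max (m : ℝ) (n : ℝ) := le_max_of_le_left (by exact_mod_cast hm)
    have := Real.log_le_log (by norm_num) h2m
    linarith [Real.log_two_gt_d9]
  have hbound : (S.length : ℝ) ≤
      66 * ((m : ℝ) * (n : ℝ) * Real.log (max (m : ℝ) (n : ℝ))) := by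
    have h3' : (S.length : ℝ) ≤ 33 * ((m : ℝ) * n) := by exact_mod_cast h3
    have hmn : (0 : ℝ) ≤ (m : ℝ) * n := by positivity
    have := mul_le_mul_of_nonneg_left hlog hmn
    linarith
  refine ⟨⟨S, h1, h2, hbound⟩, le_trans ?_ hbound⟩
  have : pushNumber A ≤ S.length := Nat.sInf_le ⟨S.map Move.toRotation, h2, by simp⟩
  exact_mod_cast this
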